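/- **Setting.** Let $f,g:\mathbb R\to\mathbb R$ be $\mathcal C^2$ functions with $g(u)-f(u)\ge c_0$ for all $u\in\mathbb R$, for some constant $c_0>0$. Consider the conservation law $u_t+\big[\bar\theta(u_x)f(u)+(1-\bar\theta(u_x))g(u)\big]_x=0$ on the real line, where $\bar\theta(s)=1$ for $s>0$ and $\bar\theta(s)=0$ for $s<0$. For $\nu\ge 1$ let $f_\nu,g_\nu$ be the piecewise affine functions that coincide with $f,g$ at the points of $2^{-\nu}\mathbb Z$. A *front tracking solution* for $f_\nu,g_\nu$ is a function $u(t,\cdot)$, $t\ge0$, for which every time interval $[0,T]$ is divided by finitely many restarting times into intervals $[t_0,t_1]$ on each of which $u(t,\cdot)$ is piecewise constant, with fronts $x_0(t)\le\dots\le x_{N-1}(t)$ and states $\hat u_0(t)=0,\hat u_1(t),\dots,\hat u_{N-1}(t),\hat u_N(t)=0$ that are continuous on $[t_0,t_1]$, where $\hat u_\alpha$ is the left state and $\hat u_{\alpha+1}$ the right state of the front $x_\alpha$, such that for $t_0<t<t_1$: * the fronts are distinct and $\hat u_\alpha\ne\hat u_{\alpha+1}$; upward jumps satisfy the Rankine–Hugoniot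 equation and the Liu admissibility condition for the flux $f_\nu$, downward jumps those for the flux $g_\nu$; * for $1\le\alpha\le N-1$, on the bounded interval $(x_{\alpha-1},x_\alpha)$ the value $\hat u_\alpha$ satisfies $\frac{d}{dt}\hat u_\alpha=\frac{f_\nu(\hat u_\alpha)-g_\nu(\hat u_\alpha)}{x_\alpha-x_{\alpha-1}}$ if it is a local maximum ($\hat u_\alpha>\max\{\hat u_{\alpha-1},\hat u_{\alpha+1}\}$), $\frac{d}{dt}\hat u_\alpha=\frac{g_\nu(\hat u_\alpha)-f_\nu(\hat u_\alpha)}{x_\alpha-x_{\alpha-1}}$ if it is a local minimum ($\hat u_\alpha<\min\{\hat u_{\alpha-1},\hat u_{\alpha+1}\}$), and $\frac{d}{dt}\hat u_\alpha=0$ otherwise. For $\bar u\in\mathbf L^1(\mathbb R)$ and $t\ge0$, let $S^\nu_t\bar u=\lim_{k\to\infty}u_k(t,\cdot)$ in $\mathbf L^1(\mathbb R)$, where the $u_k$ are front tracking solutions for $f_\nu,g_\nu$ whose initial data $u_k(0,\cdot)$ take values in $2^{-k}\mathbb Z$ and converge to $\bar u$ in $\mathbf L^1(\mathbb R)$. The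 *semigroup solution* with initial data $\bar u$ is the limit $S_t\bar u=\lim_{\nu\to\infty}S^\nu_t\bar u$ in $\mathbf L^1(\mathbb R)$, $t\ge0$. **Proposition.** For every $\bar u\in\mathbf L^1(\mathbb R)$, the semigroup solution with initial data $\bar u$ satisfies $$\|S_\tau\bar u\|_{\mathbf L^\infty}<\infty\quad\text{for all }\tau>0,\qquad\qquad S_\tau\bar u=0\quad\text{for all }\tau\ge\frac1{c_0}\int_{\mathbb R}|\bar u(x)|\,dx .$$ -/

import Mathlib

open MeasureTheory Filter Topology Set

noncomputable section

/-- The piecewise affine function that coincides with `f` at the points `2 ^ (-ν) * j`, `j ∈ ℤ`: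
with `uⱼ = j / 2 ^ ν` its value at `u ∈ [uⱼ, uⱼ₊₁]` is
`2 ^ ν * ((u - uⱼ) * f uⱼ₊₁ + (uⱼ₊₁ - u) * f uⱼ)`. -/
def gridInterp (ν : ℕ) (f : ℝ → ℝ) (u : ℝ) : ℝ :=
  2 ^ ν * ((u - (⌊2 ^ ν * u⌋ : ℝ) / 2 ^ ν) * f (((⌊2 ^ ν * u⌋ : ℝ) + 1) / 2 ^ ν)
    + (((⌊2 ^ ν * u⌋ : ℝ) + 1) / 2 ^ ν - u) * f ((⌊2 ^ ν * u⌋ : ℝ) / 2 ^ ν))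

/-- The flux that governs a jump with left state `a` and right state `b`: it is `f` for an upward
jump and `g` for a downward jump. -/
def jumpFlux (f g : ℝ → ℝ) (a b : ℝ) : ℝ → ℝ := if a < b then f else g

/-- The Liu admissibility condition for a jump with left state `a` and right state `b` in a
conservation law with flux `F`: the Rankine-Hugoniot speed of the jump is not larger than the speed
of the jump from `a` to any intermediate state. (`slope F a b = (F b - F a) / (b - a)`.) -/
def LiuAdmissible (F : ℝ → ℝ) (a b : ℝ) : Prop :=
  ∀ w ∈ Ioo (min a b) (max a b), slope F a b ≤ slope F a w

/-- The time derivative of the value `c` attained on a bounded interval of length `ℓ`, when the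
values on the two adjacent intervals are `a` and `b`: a local maximum has a sink, a local minimum
has a source, any other value stays constant. -/
def plateauRate (f g : ℝ → ℝ) (a c b ℓ : ℝ) : ℝ :=
  if a < c ∧ b < c then (f c - g c) / ℓ
  else if c < a ∧ c < b then (g c - f c) / ℓ
  else 0

/-- `u` is given on the time interval `[t₀, t₁]` by a front tracking pattern with fluxes `f`, `g`,
without restarting times in the open interval. There are `N` fronts, located at
`x 0 t < x 1 t < ⋯ < x (N - 1) t`; the front at `x α t` has left state `v α t` and right state
`v (α + 1) t`. The states on the two unbounded intervals are `0`, since `u` is integrable.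
At the end points of the time interval fronts may coincide (a Riemann fan opens, fronts interact)
and jumps may vanish. The profile `u t` is normalized to be left continuous: its value at `y` is the
state whose index is the number of fronts strictly to the left of `y`. -/
structure IsFrontPattern (f g : ℝ → ℝ) (u : ℝ → ℝ → ℝ) (t₀ t₁ : ℝ)
    (N : ℕ) (x v : ℕ → ℝ → ℝ) : Prop where
  continuousOn_front : ∀ α < N, ContinuousOn (x α) (Icc t₀ t₁)
  continuousOn_state : ∀ α ≤ N, ContinuousOn (v α) (Icc t₀ t₁)
  leftmost : ∀ t ∈ Icc t₀ t₁, v 0 t = 0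
  rightmost : ∀ t ∈ Icc t₀ t₁, v N t = 0
  ordered : ∀ α, α + 1 < N → ∀ t ∈ Ioo t₀ t₁, x α t < x (α + 1) t
  jump : ∀ α < N, ∀ t ∈ Ioo t₀ t₁, v α t ≠ v (α + 1) t
  rankineHugoniot : ∀ α < N, ∀ t ∈ Ioo t₀ t₁,
    HasDerivAt (x α)
      (slope (jumpFlux f g (v α t) (v (α + 1) t)) (v α t) (v (α + 1) t)) t
  liu : ∀ α < N, ∀ t ∈ Ioo t₀ t₁,
    LiuAdmissible (jumpFlux f g (v α t) (v (α + 1) t)) (v α t) (v (α + 1) t)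
  plateau : ∀ α, α + 1 < N → ∀ t ∈ Ioo t₀ t₁,
    HasDerivAt (v (α + 1))
      (plateauRate f g (v α t) (v (α + 1) t) (v (α + 2) t) (x (α + 1) t - x α t)) t
  profile : ∀ t ∈ Icc t₀ t₁, ∀ y : ℝ,
    u t y = v ((Finset.range N).filter (fun α => x α t < y)).card t

/-- `u` is a global front tracking solution with fluxes `f`, `g` (to be applied to piecewise affine
fluxes): every time interval `[0, T]` is divided by finitely many restarting times into intervals on
which `u` is given by a front tracking pattern. In particular `u 0` is piecewise constant with
bounded support. -/
def IsFrontTrackingSolution (f g : ℝ → ℝ) (u : ℝ → ℝ → ℝ) : Prop :=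
  ∀ T : ℝ, 0 < T → ∃ (n : ℕ) (s : ℕ → ℝ), s 0 = 0 ∧ s n = T ∧
    ∀ i < n, s i < s (i + 1) ∧
      ∃ (N : ℕ) (x v : ℕ → ℝ → ℝ), IsFrontPattern f g u (s i) (s (i + 1)) N x v

/-- `w t = S^ν_t ubar` for all `t ≥ 0`: `w` is the limit in `L¹`, as `k → ∞`, of front tracking
solutions for the piecewise affine fluxes `f_ν`, `g_ν`, whose initial data take values in
`2 ^ (-k) ℤ` and converge to `ubar` in `L¹`. -/
def IsApproxSemigroupSolution (f g : ℝ → ℝ) (ν : ℕ)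
    (ubar : ℝ →₁[volume] ℝ) (w : ℝ → (ℝ →₁[volume] ℝ)) : Prop :=
  ∃ u : ℕ → ℝ → ℝ → ℝ,
    (∀ k, IsFrontTrackingSolution (gridInterp ν f) (gridInterp ν g) (u k)) ∧
    (∀ k y, ∃ j : ℤ, u k 0 y = (j : ℝ) / 2 ^ k) ∧
    Tendsto (fun k => eLpNorm (fun y => u k 0 y - ubar y) 1 volume) atTop (𝓝 0) ∧
    ∀ t : ℝ, 0 ≤ t →
      Tendsto (fun k => eLpNorm (fun y => u k t y - w t y) 1 volume) atTop (𝓝 0)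

/-- `u t = S_t ubar` for all `t ≥ 0`: `u` is the semigroup solution with initial data `ubar`, the
limit in `L¹` of `S^ν_t ubar` as `ν → ∞`. -/
def IsSemigroupSolution (f g : ℝ → ℝ)
    (ubar : ℝ →₁[volume] ℝ) (u : ℝ → (ℝ →₁[volume] ℝ)) : Prop :=
  ∃ w : ℕ → ℝ → (ℝ →₁[volume] ℝ),
    (∀ ν, 1 ≤ ν → IsApproxSemigroupSolution f g ν ubar (w ν)) ∧
    ∀ t : ℝ, 0 ≤ t → Tendsto (fun ν => w ν t) atTop (𝓝 (u t))

end

/-!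
The proof follows the mass above a level `h ≥ 0`, that is `∫ max (u t y - h) 0 dy`. For a front
tracking solution this is a finite sum over the plateaus. The source of a plateau is exactly the
jump of the flux between its two ends (`plateauRate_mul`), so summation by parts turns the time
derivative of the mass into a sum over the fronts, in which only the fronts that cross the level `h`
survive. By the Liu condition with intermediate state `h` an upward crossing contributes at most
`f h` and a downward crossing at most `-g h` (`front_contribution_le`). Since the profile vanishes at
both ends, there are as many upward as downward crossings, and at least one of each while the mass
is positive. Hence the mass decreases at rate at least `g h - f h ≥ c₀` until it vanishes
(`IsFrontPattern.exists_hasDerivWithinAt_mass`). The positive part is not differentiable at `0`, so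
the argument uses right derivatives.

The bound
`∫ max (u T y - h) 0 dy ≤ max (∫ max (u 0 y - h) 0 dy - c₀ * T) 0`
does not depend on the approximation, because the piecewise affine fluxes inherit
`c₀ ≤ g - f` (`le_gridInterp_sub`), and it is stable under `L¹` limits; so it holds for the semigroup
solution (`IsSemigroupSolution.lintegral_ofReal_sub_le`). The reflection `u ↦ -u` gives the same bound
for the mass below `-h`. Level `h = 0` gives the extinction in finite time. For the boundedness at
time `τ > 0` it suffices to choose `h` so large that the initial mass beyond the levels `±h` is less
than `c₀ * τ`.
-/

/-! ### Piecewise constant profiles -/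

section Profile

variable {N : ℕ} {p : ℕ → ℝ}

/-- For ordered points, counting the points to the left of `y` locates `y`. -/
theorem card_filter_lt_eq_succ_iff (hp : MonotoneOn p (Iio N)) {α : ℕ} (hα : α + 1 < N) (y : ℝ) :
    ((Finset.range N).filter (fun β => p β < y)).card = α + 1 ↔ y ∈ Ioc (p α) (p (α + 1)) := by
  constructor
  · intro h
    constructor
    · by_contra! hy
      have hsub : (Finset.range N).filter (fun β => p β < y) ⊆ Finset.range α := by
        intro β hβ
        simp only [Finset.mem_filter, Finset.mem_range] at hβ ⊢
        by_contra! hab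
        have := hp (show α ∈ Iio N by simp; omega) (show β ∈ Iio N from hβ.1) hab
        linarith [hβ.2]
      have := Finset.card_le_card hsub
      simp only [Finset.card_range] at this
      omega
    · by_contra! hy
      have hsub : Finset.range (α + 2) ⊆ (Finset.range N).filter (fun β => p β < y) := by
        intro β hβ
        simp only [Finset.mem_filter, Finset.mem_range] at hβ ⊢
        have hβN : β < N := by omega
        have := hp (show β ∈ Iio N from hβN) (show α + 1 ∈ Iio N from hα) (by omega)
        exact ⟨hβN, by linarith⟩
      have := Finset.card_le_card hsub
      simp only [Finset.card_range] at this
      omega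
  · rintro ⟨h1, h2⟩
    have : (Finset.range N).filter (fun β => p β < y) = Finset.range (α + 1) := by
      ext β
      simp only [Finset.mem_filter, Finset.mem_range]
      constructor
      · rintro ⟨hβ, hy⟩
        by_contra! hab
        have := hp (show α + 1 ∈ Iio N from hα) (show β ∈ Iio N from hβ) hab
        linarith
      · intro hβ
        have hβN : β < N := by omega
        have := hp (show β ∈ Iio N from hβN) (show α ∈ Iio N by simp; omega) (by omega)
        exact ⟨hβN, by linarith⟩
    rw [this, Finset.card_range]

/-- A profile that vanishes on both unbounded intervals, as a sum over the bounded ones. -/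
theorem profile_eq_sum_indicator {M : Type*} [AddCommMonoid M] (hp : MonotoneOn p (Iio N))
    {G : ℕ → M} (h0 : G 0 = 0) (hN : G N = 0) (y : ℝ) :
    G ((Finset.range N).filter (fun β => p β < y)).card
      = ∑ α ∈ Finset.range (N - 1), (Ioc (p α) (p (α + 1))).indicator (fun _ => G (α + 1)) y := by
  set m := ((Finset.range N).filter (fun β => p β < y)).card with hm
  have hmN : m ≤ N := by
    simpa using Finset.card_filter_le (Finset.range N) (fun β => p β < y)
  have key : ∀ α ∈ Finset.range (N - 1),
      (Ioc (p α) (p (α + 1))).indicator (fun _ => G (α + 1)) y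
        = if α = m - 1 then (if m = 0 then 0 else G m) else 0 := by
    intro α hα
    simp only [Finset.mem_range] at hα
    rw [indicator_apply]
    simp only [← card_filter_lt_eq_succ_iff hp (show α + 1 < N by omega) y, ← hm]
    by_cases h : m = α + 1
    · simp [h]
    · rw [if_neg h]
      split_ifs <;> first | rfl | omega
  rw [Finset.sum_congr rfl key, Finset.sum_ite_eq']
  rcases Nat.eq_zero_or_pos m with h | h
  · simp [h, h0]
  · rcases hmN.eq_or_lt with h' | h'
    · rw [if_neg (by simp; omega), h', hN]
    · rw [if_pos (by simp; omega), if_neg h.ne']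

theorem measurable_profile (hp : MonotoneOn p (Iio N)) {c : ℕ → ℝ} (h0 : c 0 = 0) (hN : c N = 0) :
    Measurable fun y => c ((Finset.range N).filter (fun β => p β < y)).card := by
  simp_rw [profile_eq_sum_indicator hp h0 hN]
  exact Finset.measurable_sum _ fun α _ => measurable_const.indicator measurableSet_Ioc

/-- The integral of the positive part of a piecewise constant profile; the values `c 0` and `c N` on
the unbounded intervals do not contribute. -/
theorem lintegral_profile (hp : MonotoneOn p (Iio N)) {c : ℕ → ℝ} (h0 : c 0 ≤ 0) (hN : c N ≤ 0) :
    ∫⁻ y, ENNReal.ofReal (c ((Finset.range N).filter (fun β => p β < y)).card)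
      = ENNReal.ofReal (∑ α ∈ Finset.range (N - 1), max (c (α + 1)) 0 * (p (α + 1) - p α)) := by
  have hrep := profile_eq_sum_indicator hp (G := fun i => ENNReal.ofReal (c i))
    (ENNReal.ofReal_of_nonpos h0) (ENNReal.ofReal_of_nonpos hN)
  simp only [hrep]
  rw [lintegral_finsetSum _ fun α _ => measurable_const.indicator measurableSet_Ioc,
    ENNReal.ofReal_sum_of_nonneg]
  · refine Finset.sum_congr rfl fun α _ => ?_
    rw [lintegral_indicator_const measurableSet_Ioc, Real.volume_Ioc,
      ENNReal.ofReal_mul (le_max_right _ _), ENNReal.ofReal_max, ENNReal.ofReal_zero, max_eq_left]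
    exact zero_le
  · intro α hα
    simp only [Finset.mem_range] at hα
    exact mul_nonneg (le_max_right _ _) (sub_nonneg.2
      (hp (show α ∈ Iio N by simp; omega) (show α + 1 ∈ Iio N by simp; omega) (by omega)))

end Profile

/-! ### One-sided derivatives -/

/-- The right derivative of the positive part of `w`; the factor `s` is an element of the
subdifferential of the positive part at `w t`. -/
theorem exists_hasDerivWithinAt_max_zero {w : ℝ → ℝ} {w' t : ℝ} (hw : HasDerivAt w w' t) :
    ∃ s : ℝ, (s = 0 ∨ s = 1) ∧ (0 < w t → s = 1) ∧ (w t < 0 → s = 0) ∧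
      HasDerivWithinAt (fun r => max (w r) 0) (s * w') (Ici t) t := by
  rcases lt_trichotomy (w t) 0 with h | h | h
  · refine ⟨0, .inl rfl, fun h' => by linarith, fun _ => rfl, ?_⟩
    have : (fun r => max (w r) 0) =ᶠ[𝓝 t] fun _ => 0 := by
      filter_upwards [hw.continuousAt.eventually_lt_const h] with r hr using max_eq_right hr.le
    rw [zero_mul]
    exact ((hasDerivAt_const t (0 : ℝ)).congr_of_eventuallyEq this).hasDerivWithinAt
  · have hmax : HasDerivWithinAt (fun r => max (w r) 0) (max w' 0) (Ici t) t := by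
      rw [hasDerivWithinAt_iff_tendsto_slope, Ici_sdiff_left]
      have hs := (hasDerivWithinAt_iff_tendsto_slope' (s := Ioi t) (by simp)).1
        (hw.hasDerivWithinAt (s := Ioi t))
      refine (hs.max (tendsto_const_nhds (x := (0 : ℝ)))).congr' ?_
      filter_upwards [self_mem_nhdsWithin] with r hr
      have hr' : 0 < r - t := sub_pos.2 hr
      simp only [slope_def_field, h, sub_zero, max_self]
      rw [← max_div_div_right hr'.le, zero_div]
    rcases le_total w' 0 with h' | h'
    · exact ⟨0, .inl rfl, fun h' => by linarith, fun _ => rfl, by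
        rw [max_eq_right h'] at hmax; rwa [zero_mul]⟩
    · exact ⟨1, .inr rfl, fun _ => rfl, fun h' => by linarith, by
        rw [max_eq_left h'] at hmax; rwa [one_mul]⟩
  · refine ⟨1, .inr rfl, fun _ => rfl, fun h' => by linarith, ?_⟩
    have : (fun r => max (w r) 0) =ᶠ[𝓝 t] w := by
      filter_upwards [hw.continuousAt.eventually_const_lt h] with r hr using max_eq_left hr.le
    rw [one_mul]
    exact (hw.congr_of_eventuallyEq this).hasDerivWithinAt

/-- A mean value inequality for right derivatives on the open interval: nothing is assumed about the
derivative at the left end point. -/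
theorem sub_le_mul_of_hasDerivWithinAt_Ici_le {E : ℝ → ℝ} {a b C : ℝ} (hab : a ≤ b)
    (hE : ContinuousOn E (Icc a b))
    (hd : ∀ t ∈ Ioo a b, ∃ E' ≤ C, HasDerivWithinAt E E' (Ici t) t) :
    E b - E a ≤ C * (b - a) := by
  rcases hab.eq_or_lt with rfl | hab
  · simp
  choose! E' hE'C hE' using hd
  have key : ∀ a' ∈ Ioo a b, E b ≤ E a' + C * (b - a') := by
    intro a' ha'
    exact image_le_of_deriv_right_le_deriv_boundary
      (hE.mono (Icc_subset_Icc_left ha'.1.le))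
      (fun t ht => hE' t ⟨ha'.1.trans_le ht.1, ht.2⟩)
      (B := fun t => E a' + C * (t - a')) (B' := fun _ => C) (by simp) (by fun_prop)
      (fun t _ => by
        simpa using ((((hasDerivAt_id t).sub_const a').const_mul C).const_add
          (E a')).hasDerivWithinAt)
      (fun t ht => hE'C t ⟨ha'.1.trans_le ht.1, ht.2⟩) (right_mem_Icc.2 ha'.2.le)
  have hlim : Tendsto (fun a' => E a' + C * (b - a')) (𝓝[Ioo a b] a)
      (𝓝 (E a + C * (b - a))) := by
    have h1 : ContinuousWithinAt E (Ioo a b) a :=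
      (hE a (left_mem_Icc.2 hab.le)).mono Ioo_subset_Icc_self
    exact (h1.add (by fun_prop : ContinuousWithinAt (fun a' => C * (b - a')) (Ioo a b) a)).tendsto
  have : (𝓝[Ioo a b] a).NeBot := by
    rw [nhdsWithin_Ioo_eq_nhdsGT hab]; infer_instance
  have := ge_of_tendsto hlim (by filter_upwards [self_mem_nhdsWithin] with r hr using key r hr)
  linarith

/-- A quantity that does not increase, and decreases at rate at least `C` while it is positive. -/
theorem le_max_of_hasDerivWithinAt_Ici_le {E : ℝ → ℝ} {a b C : ℝ} (hab : a ≤ b)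
    (hE : ContinuousOn E (Icc a b))
    (hd : ∀ t ∈ Ioo a b, ∃ E' ≤ 0, (0 < E t → E' ≤ -C) ∧ HasDerivWithinAt E E' (Ici t) t) :
    E b ≤ max (E a - C * (b - a)) 0 := by
  rcases le_or_gt (E b) 0 with hb | hb
  · exact hb.trans (le_max_right _ _)
  refine le_trans ?_ (le_max_left _ _)
  have hpos : ∀ t ∈ Ioo a b, 0 < E t := by
    intro t ht
    have := sub_le_mul_of_hasDerivWithinAt_Ici_le (C := 0) ht.2.le
      (hE.mono (Icc_subset_Icc_left ht.1.le))
      (fun r hr => (hd r ⟨ht.1.trans hr.1, hr.2⟩).imp fun E' h => ⟨h.1, h.2.2⟩)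
    linarith
  have := sub_le_mul_of_hasDerivWithinAt_Ici_le (C := -C) hab hE
    (fun r hr => (hd r hr).imp fun E' h => ⟨h.2.1 (hpos r hr), h.2.2⟩)
  linarith

/-! ### Decay of the mass above a level -/

theorem sum_mul_sub_eq_sum_sub_mul (s Q : ℕ → ℝ) (n : ℕ) :
    ∑ α ∈ Finset.range n, s (α + 1) * (Q α - Q (α + 1))
      = ∑ α ∈ Finset.range (n + 1), (s (α + 1) - s α) * Q α - s (n + 1) * Q n + s 0 * Q 0 := by
  induction n with
  | zero => simp; ring
  | succ n ih => rw [Finset.sum_range_succ, ih, Finset.sum_range_succ _ (n + 1)]; ring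

/-- From a value `s β` down to `0` the total decrease is at least `s β`. -/
theorem sum_min_sub_zero_le_neg {s : ℕ → ℝ} {N β : ℕ} (hβ : β ≤ N) (hN : s N = 0) :
    ∑ α ∈ Finset.range N, min (s (α + 1) - s α) 0 ≤ -s β := by
  calc ∑ α ∈ Finset.range N, min (s (α + 1) - s α) 0
      ≤ ∑ α ∈ Finset.Ico β N, min (s (α + 1) - s α) 0 := by
        refine Finset.sum_le_sum_of_subset_of_nonpos' ?_ fun _ _ _ => min_le_right _ _
        intro α hα
        simp only [Finset.mem_Ico, Finset.mem_range] at hα ⊢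
        exact hα.2
    _ ≤ ∑ α ∈ Finset.Ico β N, (s (α + 1) - s α) := Finset.sum_le_sum fun _ _ => min_le_left _ _
    _ = -s β := by rw [Finset.sum_Ico_sub _ hβ, hN, zero_sub]

/-- The source of a plateau is the jump of the flux seen by its two ends, so that the law for the
plateaus is the conservation law with flux `f` at upward and `g` at downward jumps. -/
theorem plateauRate_mul (f g : ℝ → ℝ) {a c b ℓ : ℝ} (hac : a ≠ c) (hcb : c ≠ b) (hℓ : ℓ ≠ 0) :
    plateauRate f g a c b ℓ * ℓ = jumpFlux f g a c c - jumpFlux f g c b c := by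
  unfold plateauRate jumpFlux
  rcases hac.lt_or_gt with h1 | h1 <;> rcases hcb.lt_or_gt with h2 | h2 <;>
    simp [h1, h2, h1.not_gt, h2.not_gt, hℓ]

/-- The contribution of one front to the rate of change of the mass above `h`. The front relates
the states `a` and `b`, and `sa`, `sb` belong to the subdifferential of `u ↦ max (u - h) 0` at
these states. If the front crosses the level `h`, the Liu condition with intermediate state `h`
bounds the relative flux by the flux at `h`. -/
theorem front_contribution_le {f g : ℝ → ℝ} {c₀ h a b sa sb : ℝ}
    (hfg : c₀ ≤ g h - f h) (hab : a ≠ b) (hL : LiuAdmissible (jumpFlux f g a b) a b)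
    (hsa : sa = 0 ∨ sa = 1) (hsa1 : h < a → sa = 1) (hsa0 : a < h → sa = 0)
    (hsb : sb = 0 ∨ sb = 1) (hsb1 : h < b → sb = 1) (hsb0 : b < h → sb = 0) :
    (sb - sa) * (jumpFlux f g a b a - (a - h) * slope (jumpFlux f g a b) a b)
      ≤ (sb - sa) * f h + min (sb - sa) 0 * c₀ := by
  set F := jumpFlux f g a b with hF
  have hba : b - a ≠ 0 := sub_ne_zero.2 hab.symm
  have hQb : F a - (a - h) * slope F a b = F b - (b - h) * slope F a b := by
    rw [slope_def_field]; field_simp; ring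
  -- The relative flux at a front that crosses the level `h`.
  have hup : a < b → a ≤ h → h ≤ b → F a - (a - h) * slope F a b ≤ F h := by
    intro h1 h2 h3
    rcases h2.eq_or_lt with rfl | h2
    · simp
    rcases h3.eq_or_lt with rfl | h3
    · simp [hQb]
    have := hL h ⟨by rwa [min_eq_left h1.le], by rwa [max_eq_right h1.le]⟩
    rw [slope_def_field F a h, le_div_iff₀ (sub_pos.2 h2)] at this
    linarith
  have hdown : b < a → b ≤ h → h ≤ a → F h ≤ F a - (a - h) * slope F a b := by
    intro h1 h2 h3
    rcases h2.eq_or_lt with rfl | h2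
    · simp [hQb]
    rcases h3.eq_or_lt with rfl | h3
    · simp
    have := hL h ⟨by rwa [min_eq_right h1.le], by rwa [max_eq_left h1.le]⟩
    rw [slope_def_field F a h, le_div_iff_of_neg (sub_neg.2 h3)] at this
    linarith
  rcases hsa with h1 | h1 <;> rcases hsb with h2 | h2
  · simp [h1, h2]
  · have ha : a ≤ h := by by_contra! hh; linarith [hsa1 hh]
    have hb : h ≤ b := by by_contra! hh; linarith [hsb0 hh]
    have hlt := lt_of_le_of_ne (ha.trans hb) hab
    have := hup hlt ha hb
    have hFf : F = f := if_pos hlt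
    rw [hFf] at this ⊢
    rw [h1, h2]
    norm_num
    linarith
  · have ha : h ≤ a := by by_contra! hh; linarith [hsa0 hh]
    have hb : b ≤ h := by by_contra! hh; linarith [hsb1 hh]
    have hlt := lt_of_le_of_ne (hb.trans ha) hab.symm
    have := hdown hlt hb ha
    have hFg : F = g := if_neg hlt.not_gt
    rw [hFg] at this ⊢
    rw [h1, h2]
    norm_num
    linarith
  · simp [h1, h2]

namespace IsFrontPattern

variable {f g : ℝ → ℝ} {u : ℝ → ℝ → ℝ} {t₀ t₁ : ℝ} {N : ℕ} {x v : ℕ → ℝ → ℝ}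

/-- At the end points of the time interval the fronts are ordered only weakly, by continuity. -/
theorem monotoneOn_front (H : IsFrontPattern f g u t₀ t₁ N x v) (ht : t₀ < t₁) {t : ℝ}
    (htI : t ∈ Icc t₀ t₁) : MonotoneOn (fun α => x α t) (Iio N) := by
  have step : ∀ α, α + 1 < N → x α t ≤ x (α + 1) t := by
    intro α hα
    rw [← closure_Ioo ht.ne] at htI
    refine ContinuousWithinAt.closure_le htI ?_ ?_ fun r hr => (H.ordered α hα r hr).le <;>
    · rw [closure_Ioo ht.ne] at htI
      exact (H.continuousOn_front _ (by omega) t htI).mono Ioo_subset_Icc_self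
  intro α _ β hβ hαβ
  induction β, hαβ using Nat.le_induction with
  | base => exact le_rfl
  | succ β _ ih =>
    have hβ' : β + 1 < N := hβ
    exact (ih (show β < N by omega)).trans (step β hβ')

theorem measurable (H : IsFrontPattern f g u t₀ t₁ N x v) (ht : t₀ < t₁) {t : ℝ}
    (htI : t ∈ Icc t₀ t₁) : Measurable (u t) := by
  have : u t = _ := funext (H.profile t htI)
  rw [this]
  exact measurable_profile (H.monotoneOn_front ht htI) (c := fun α => v α t)
    (H.leftmost t htI) (H.rightmost t htI)

theorem lintegral_ofReal_sub (H : IsFrontPattern f g u t₀ t₁ N x v) (ht : t₀ < t₁) {h : ℝ}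
    (hh : 0 ≤ h) {t : ℝ} (htI : t ∈ Icc t₀ t₁) :
    ∫⁻ y, ENNReal.ofReal (u t y - h) = ENNReal.ofReal
      (∑ α ∈ Finset.range (N - 1), max (v (α + 1) t - h) 0 * (x (α + 1) t - x α t)) := by
  simp_rw [H.profile t htI]
  exact lintegral_profile (H.monotoneOn_front ht htI) (c := fun α => v α t - h)
    (by simp [H.leftmost t htI, hh]) (by simp [H.rightmost t htI, hh])

/-- The mass above a level `h ≥ 0` decreases, at rate at least `c₀` while it is positive. -/
theorem exists_hasDerivWithinAt_mass (H : IsFrontPattern f g u t₀ t₁ N x v) {c₀ : ℝ}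
    (hc₀ : 0 < c₀) (hfg : ∀ w, c₀ ≤ g w - f w) {h : ℝ} (hh : 0 ≤ h) {t : ℝ}
    (htI : t ∈ Ioo t₀ t₁) :
    ∃ E' ≤ 0,
      (0 < ∑ α ∈ Finset.range (N - 1), max (v (α + 1) t - h) 0 * (x (α + 1) t - x α t) →
        E' ≤ -c₀) ∧
      HasDerivWithinAt
        (fun r => ∑ α ∈ Finset.range (N - 1), max (v (α + 1) r - h) 0 * (x (α + 1) r - x α r))
        E' (Ici t) t := by
  rcases Nat.lt_or_ge N 2 with hN | hN
  · have : N - 1 = 0 := by omega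
    simp only [this, Finset.range_zero, Finset.sum_empty]
    exact ⟨0, le_rfl, by simp, hasDerivWithinAt_const _ _ _⟩
  obtain ⟨n, rfl⟩ : ∃ n, N = n + 1 := ⟨N - 1, by omega⟩
  simp only [Nat.add_sub_cancel]
  have htI' := Ioo_subset_Icc_self htI
  -- The choice `0` at both unbounded intervals makes the boundary terms of the summation vanish.
  have hs : ∀ α, ∃ s : ℝ, (s = 0 ∨ s = 1) ∧ (α ≤ n + 1 → h < v α t → s = 1) ∧
      (α ≤ n + 1 → v α t < h → s = 0) ∧ (α = 0 ∨ α = n + 1 → s = 0) ∧ ∀ β, α = β + 1 → β < n →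
      HasDerivWithinAt (fun r => max (v α r - h) 0)
        (s * plateauRate f g (v β t) (v (β + 1) t) (v (β + 2) t) (x (β + 1) t - x β t))
        (Ici t) t := by
    intro α
    by_cases hα : α = 0 ∨ n + 1 ≤ α
    · refine ⟨0, .inl rfl, fun h1 h2 => ?_, fun _ _ => rfl, fun _ => rfl, fun β h1 h2 => by omega⟩
      have : v α t = 0 := by
        rcases hα with rfl | hα
        · exact H.leftmost t htI'
        · rw [le_antisymm h1 hα]; exact H.rightmost t htI'
      linarith
    · obtain ⟨β, rfl⟩ : ∃ β, α = β + 1 := ⟨α - 1, by omega⟩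
      obtain ⟨s, h1, h2, h3, h4⟩ := exists_hasDerivWithinAt_max_zero
        ((H.plateau β (by omega) t htI).sub_const h)
      refine ⟨s, h1, fun _ h => h2 (by linarith), fun _ h => h3 (by linarith),
        fun h => by omega, ?_⟩
      rintro γ hγ -
      obtain rfl : β = γ := by omega
      exact h4
  choose s hs01 hs1 hs0 hsb hsd using hs
  set F : ℕ → ℝ → ℝ := fun α => jumpFlux f g (v α t) (v (α + 1) t) with hF
  set σ : ℕ → ℝ := fun α => slope (F α) (v α t) (v (α + 1) t) with hσ
  set Q : ℕ → ℝ := fun α => F α (v α t) - (v α t - h) * σ α with hQ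
  have hder : HasDerivWithinAt
      (fun r => ∑ α ∈ Finset.range n, max (v (α + 1) r - h) 0 * (x (α + 1) r - x α r))
      (∑ α ∈ Finset.range n, s (α + 1) * (Q α - Q (α + 1))) (Ici t) t := by
    refine HasDerivWithinAt.fun_sum fun α hα => ?_
    have hα : α < n := Finset.mem_range.1 hα
    have h1 := hsd (α + 1) α rfl hα
    have h2 := (H.rankineHugoniot (α + 1) (by omega) t htI).hasDerivWithinAt (s := Ici t)
    have h3 := (H.rankineHugoniot α (by omega) t htI).hasDerivWithinAt (s := Ici t)
    refine (h1.mul (h2.sub h3)).congr_deriv ?_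
    have hj := H.jump α (by omega) t htI
    have hrate := plateauRate_mul f g hj (H.jump (α + 1) (by omega) t htI)
      (sub_pos.2 (H.ordered α (by omega) t htI)).ne'
    have hpos : max (v (α + 1) t - h) 0 = s (α + 1) * (v (α + 1) t - h) := by
      rcases lt_trichotomy (v (α + 1) t) h with hlt | heq | hgt
      · rw [hs0 _ (by omega) hlt, max_eq_right (by linarith)]; ring
      · simp [heq]
      · rw [hs1 _ (by omega) hgt, max_eq_left (by linarith)]; ring
    -- The Rankine-Hugoniot equation, for the relative flux seen from the right state.
    have hRH : Q α = F α (v (α + 1) t) - (v (α + 1) t - h) * σ α := by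
      have : v (α + 1) t - v α t ≠ 0 := sub_ne_zero.2 hj.symm
      simp only [hQ, hσ, slope_def_field]
      field_simp
      ring
    rw [hpos, mul_assoc, Pi.sub_apply, hrate, hRH]
    simp only [hQ, hσ, hF]
    ring
  have hsum : ∑ α ∈ Finset.range n, s (α + 1) * (Q α - Q (α + 1))
      ≤ (∑ α ∈ Finset.range (n + 1), min (s (α + 1) - s α) 0) * c₀ := by
    rw [sum_mul_sub_eq_sum_sub_mul, hsb 0 (.inl rfl), hsb (n + 1) (.inr rfl)]
    calc _ = ∑ α ∈ Finset.range (n + 1), (s (α + 1) - s α) * Q α := by ring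
      _ ≤ ∑ α ∈ Finset.range (n + 1), ((s (α + 1) - s α) * f h + min (s (α + 1) - s α) 0 * c₀) := by
        refine Finset.sum_le_sum fun α hα => ?_
        have hα := Finset.mem_range.1 hα
        exact front_contribution_le (hfg h) (H.jump α hα t htI) (H.liu α hα t htI)
          (hs01 _) (hs1 _ (by omega)) (hs0 _ (by omega))
          (hs01 _) (hs1 _ (by omega)) (hs0 _ (by omega))
      _ = _ := by
        rw [Finset.sum_add_distrib, ← Finset.sum_mul, ← Finset.sum_mul, Finset.sum_range_sub,
          hsb 0 (.inl rfl), hsb (n + 1) (.inr rfl)]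
        ring
  refine ⟨_, hsum.trans (mul_nonpos_of_nonpos_of_nonneg
    (Finset.sum_nonpos fun _ _ => min_le_right _ _) hc₀.le), fun hE => hsum.trans ?_, hder⟩
  obtain ⟨α, hα, hα'⟩ := Finset.exists_lt_of_sum_lt (s := Finset.range n) (f := fun _ => (0 : ℝ))
    (by simpa using hE)
  have hα := Finset.mem_range.1 hα
  have hv : h < v (α + 1) t := by
    by_contra! hle
    simp [max_eq_right (sub_nonpos.2 hle)] at hα'
  have := sum_min_sub_zero_le_neg (s := s) (show α + 1 ≤ n + 1 by omega) (hsb _ (.inr rfl))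
  rw [hs1 (α + 1) (by omega) hv] at this
  nlinarith

theorem lintegral_ofReal_sub_le (H : IsFrontPattern f g u t₀ t₁ N x v) (ht : t₀ < t₁) {c₀ : ℝ}
    (hc₀ : 0 < c₀) (hfg : ∀ w, c₀ ≤ g w - f w) {h : ℝ} (hh : 0 ≤ h) :
    ∫⁻ y, ENNReal.ofReal (u t₁ y - h)
      ≤ (∫⁻ y, ENNReal.ofReal (u t₀ y - h)) - ENNReal.ofReal (c₀ * (t₁ - t₀)) := by
  rw [H.lintegral_ofReal_sub ht hh (right_mem_Icc.2 ht.le),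
    H.lintegral_ofReal_sub ht hh (left_mem_Icc.2 ht.le),
    ← ENNReal.ofReal_sub _ (mul_nonneg hc₀.le (sub_nonneg.2 ht.le))]
  have hcont : ContinuousOn (fun r => ∑ α ∈ Finset.range (N - 1),
      max (v (α + 1) r - h) 0 * (x (α + 1) r - x α r)) (Icc t₀ t₁) := by
    refine continuousOn_finsetSum _ fun α hα => ?_
    have hα := Finset.mem_range.1 hα
    exact (((H.continuousOn_state (α + 1) (by omega)).sub continuousOn_const).sup
      continuousOn_const).mul ((H.continuousOn_front (α + 1) (by omega)).sub
        (H.continuousOn_front α (by omega)))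
  have := ENNReal.ofReal_le_ofReal (le_max_of_hasDerivWithinAt_Ici_le ht.le hcont
    fun t htI => H.exists_hasDerivWithinAt_mass hc₀ hfg hh htI)
  rwa [ENNReal.ofReal_max, ENNReal.ofReal_zero, max_eq_left zero_le] at this

/-- The reflection `u ↦ -u` exchanges upward and downward jumps. -/
theorem neg (H : IsFrontPattern f g u t₀ t₁ N x v) :
    IsFrontPattern (fun w => -g (-w)) (fun w => -f (-w)) (fun t y => -u t y) t₀ t₁ N x
      (fun α t => -v α t) := by
  have hslope : ∀ (F : ℝ → ℝ) (a b : ℝ), slope (fun w => -F (-w)) (-a) (-b) = slope F a b := by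
    intro F a b
    rw [slope_def_field, slope_def_field, neg_neg, neg_neg, ← neg_div_neg_eq]
    ring_nf
  have hflux : ∀ {a b : ℝ}, a ≠ b → jumpFlux (fun w => -g (-w)) (fun w => -f (-w)) (-a) (-b)
      = fun w => -jumpFlux f g a b (-w) := by
    intro a b hab
    unfold jumpFlux
    rcases hab.lt_or_gt with h | h <;> simp [h, h.not_gt]
  refine ⟨H.continuousOn_front, fun α hα => (H.continuousOn_state α hα).neg,
    fun t ht => by simp [H.leftmost t ht], fun t ht => by simp [H.rightmost t ht], H.ordered,
    fun α hα t ht => by simpa using H.jump α hα t ht, fun α hα t ht => ?_, fun α hα t ht => ?_,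
    fun α hα t ht => ?_, fun t ht y => by simp [H.profile t ht y]⟩
  · rw [hflux (H.jump α hα t ht), hslope]
    exact H.rankineHugoniot α hα t ht
  · rw [hflux (H.jump α hα t ht)]
    intro w hw
    have := H.liu α hα t ht (-w) (by
      rw [min_neg_neg, max_neg_neg] at hw
      exact ⟨lt_neg_of_lt_neg hw.2, neg_lt_of_neg_lt hw.1⟩)
    rwa [hslope, ← neg_neg w, hslope]
  · refine (H.plateau α hα t ht).neg.congr_deriv ?_
    unfold plateauRate
    simp only [neg_lt_neg_iff, neg_neg]
    split_ifs <;> first | (exfalso; linarith) | ring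

end IsFrontPattern

namespace IsFrontTrackingSolution

variable {f g : ℝ → ℝ} {u : ℝ → ℝ → ℝ}

theorem neg (H : IsFrontTrackingSolution f g u) :
    IsFrontTrackingSolution (fun w => -g (-w)) (fun w => -f (-w)) (fun t y => -u t y) := by
  intro T hT
  obtain ⟨n, s, h0, hn, hs⟩ := H T hT
  refine ⟨n, s, h0, hn, fun i hi => ⟨(hs i hi).1, ?_⟩⟩
  obtain ⟨N, x, v, hp⟩ := (hs i hi).2
  exact ⟨N, x, _, hp.neg⟩

theorem measurable (H : IsFrontTrackingSolution f g u) {t : ℝ} (ht : 0 ≤ t) :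
    Measurable (u t) := by
  rcases ht.eq_or_lt with rfl | ht
  · obtain ⟨n, s, h0, hn, hs⟩ := H 1 one_pos
    have hn0 : 0 < n := Nat.pos_of_ne_zero (by rintro rfl; linarith)
    obtain ⟨hlt, N, x, v, hp⟩ := hs 0 hn0
    rw [← h0]
    exact hp.measurable hlt (left_mem_Icc.2 hlt.le)
  · obtain ⟨n, s, h0, hn, hs⟩ := H t ht
    obtain ⟨m, rfl⟩ := Nat.exists_eq_succ_of_ne_zero (n := n) (by rintro rfl; linarith)
    obtain ⟨hlt, N, x, v, hp⟩ := hs m m.lt_succ_self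
    rw [← hn]
    exact hp.measurable hlt (right_mem_Icc.2 hlt.le)

/-- The mass above a level `h ≥ 0` decreases at rate at least `c₀` until it vanishes (the
subtraction is truncated). -/
theorem lintegral_ofReal_sub_le (H : IsFrontTrackingSolution f g u) {c₀ : ℝ} (hc₀ : 0 < c₀)
    (hfg : ∀ w, c₀ ≤ g w - f w) {h : ℝ} (hh : 0 ≤ h) {T : ℝ} (hT : 0 ≤ T) :
    ∫⁻ y, ENNReal.ofReal (u T y - h)
      ≤ (∫⁻ y, ENNReal.ofReal (u 0 y - h)) - ENNReal.ofReal (c₀ * T) := by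
  rcases hT.eq_or_lt with rfl | hT
  · simp
  obtain ⟨n, s, h0, hn, hs⟩ := H T hT
  have key : ∀ i ≤ n, 0 ≤ s i ∧ ∫⁻ y, ENNReal.ofReal (u (s i) y - h)
      ≤ (∫⁻ y, ENNReal.ofReal (u 0 y - h)) - ENNReal.ofReal (c₀ * s i) := by
    intro i
    induction i with
    | zero => simp [h0]
    | succ i ih =>
      intro hi
      obtain ⟨ih0, ih⟩ := ih (by omega)
      obtain ⟨hlt, N, x, v, hp⟩ := hs i (by omega)
      refine ⟨by linarith, (hp.lintegral_ofReal_sub_le hlt hc₀ hfg hh).trans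
        ((tsub_le_tsub_right ih _).trans_eq ?_)⟩
      rw [tsub_tsub, ← ENNReal.ofReal_add (by positivity)
        (mul_nonneg hc₀.le (sub_nonneg.2 hlt.le))]
      congr 2
      ring
  rw [← hn]
  exact (key n le_rfl).2

end IsFrontTrackingSolution

/-! ### Passage to the limit -/

/-- Piecewise affine interpolation takes convex combinations, so it preserves a lower bound of
`g - f`. -/
theorem le_gridInterp_sub {f g : ℝ → ℝ} {c₀ : ℝ} (hfg : ∀ w, c₀ ≤ g w - f w) (ν : ℕ) (u : ℝ) :
    c₀ ≤ gridInterp ν g u - gridInterp ν f u := by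
  unfold gridInterp
  set P : ℝ := 2 ^ ν
  have hP : 0 < P := by positivity
  set j : ℝ := (⌊P * u⌋ : ℝ)
  have h1 : 0 ≤ P * (u - j / P) := by
    have : P * (u - j / P) = P * u - j := by field_simp
    rw [this]; exact sub_nonneg.2 (Int.floor_le _)
  have h2 : 0 ≤ P * ((j + 1) / P - u) := by
    have : P * ((j + 1) / P - u) = j + 1 - P * u := by field_simp
    rw [this]; exact sub_nonneg.2 (Int.lt_floor_add_one _).le
  have h3 : P * (u - j / P) + P * ((j + 1) / P - u) = 1 := by field_simp; ring
  have h4 := mul_le_mul_of_nonneg_left (hfg ((j + 1) / P)) h1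
  have h5 := mul_le_mul_of_nonneg_left (hfg (j / P)) h2
  calc c₀ = P * (u - j / P) * c₀ + P * ((j + 1) / P - u) * c₀ := by rw [← add_mul, h3, one_mul]
    _ ≤ _ := (add_le_add h4 h5)
    _ = _ := by ring

/-- The mass above a level is nonexpansive with respect to the `L¹` distance. -/
theorem lintegral_ofReal_sub_le_add_eLpNorm {a b : ℝ → ℝ} (ha : AEMeasurable a) (h : ℝ) :
    ∫⁻ y, ENNReal.ofReal (b y - h)
      ≤ (∫⁻ y, ENNReal.ofReal (a y - h)) + eLpNorm (fun y => a y - b y) 1 volume := by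
  rw [eLpNorm_one_eq_lintegral_enorm, ← lintegral_add_left' (by fun_prop)]
  refine lintegral_mono fun y => ?_
  rw [enorm_sub_rev, Real.enorm_eq_ofReal_abs]
  calc ENNReal.ofReal (b y - h) ≤ ENNReal.ofReal ((a y - h) + |b y - a y|) :=
        ENNReal.ofReal_le_ofReal (by linarith [le_abs_self (b y - a y)])
    _ ≤ _ := ENNReal.ofReal_add_le

theorem lintegral_ofReal_sub_le_of_tendsto {F G : ℝ → ℝ} {c₀ : ℝ} (hc₀ : 0 < c₀)
    (hFG : ∀ w, c₀ ≤ G w - F w) {u : ℕ → ℝ → ℝ → ℝ} (hu : ∀ k, IsFrontTrackingSolution F G (u k))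
    {a b : ℝ → ℝ} (ha : AEMeasurable a) {h : ℝ} (hh : 0 ≤ h) {T : ℝ} (hT : 0 ≤ T)
    (hua : Tendsto (fun k => eLpNorm (fun y => u k 0 y - a y) 1 volume) atTop (𝓝 0))
    (hub : Tendsto (fun k => eLpNorm (fun y => u k T y - b y) 1 volume) atTop (𝓝 0)) :
    ∫⁻ y, ENNReal.ofReal (b y - h)
      ≤ (∫⁻ y, ENNReal.ofReal (a y - h)) - ENNReal.ofReal (c₀ * T) := by
  have hlim := (tendsto_const_nhds (x := (∫⁻ y, ENNReal.ofReal (a y - h))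
    - ENNReal.ofReal (c₀ * T))).add (hua.add hub)
  simp only [add_zero] at hlim
  refine ge_of_tendsto' hlim fun k => ?_
  have h1 := lintegral_ofReal_sub_le_add_eLpNorm (b := u k 0) ha h
  have h2 := (hu k).lintegral_ofReal_sub_le hc₀ hFG hh hT
  have h3 := lintegral_ofReal_sub_le_add_eLpNorm (b := b) ((hu k).measurable hT).aemeasurable h
  rw [show eLpNorm (fun y => a y - u k 0 y) 1 volume = eLpNorm (fun y => u k 0 y - a y) 1 volume
    from eLpNorm_sub_comm a (u k 0) 1 volume] at h1
  calc _ ≤ _ := h3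
    _ ≤ _ := add_le_add_left (h2.trans ((tsub_le_tsub_right h1 _).trans add_tsub_le_tsub_add)) _
    _ = _ := add_assoc _ _ _

namespace IsApproxSemigroupSolution

variable {f g : ℝ → ℝ} {ν : ℕ} {ubar : ℝ →₁[volume] ℝ} {w : ℝ → (ℝ →₁[volume] ℝ)} {c₀ : ℝ}

theorem lintegral_ofReal_sub_le (H : IsApproxSemigroupSolution f g ν ubar w) (hc₀ : 0 < c₀)
    (hfg : ∀ u, c₀ ≤ g u - f u) {h : ℝ} (hh : 0 ≤ h) {T : ℝ} (hT : 0 ≤ T) :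
    ∫⁻ y, ENNReal.ofReal (w T y - h)
      ≤ (∫⁻ y, ENNReal.ofReal (ubar y - h)) - ENNReal.ofReal (c₀ * T) := by
  obtain ⟨u, hu, -, hu0, hut⟩ := H
  exact lintegral_ofReal_sub_le_of_tendsto hc₀ (le_gridInterp_sub hfg ν) hu
    (Lp.aestronglyMeasurable ubar).aemeasurable hh hT hu0 (hut T hT)

theorem lintegral_ofReal_neg_sub_le (H : IsApproxSemigroupSolution f g ν ubar w) (hc₀ : 0 < c₀)
    (hfg : ∀ u, c₀ ≤ g u - f u) {h : ℝ} (hh : 0 ≤ h) {T : ℝ} (hT : 0 ≤ T) :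
    ∫⁻ y, ENNReal.ofReal (-w T y - h)
      ≤ (∫⁻ y, ENNReal.ofReal (-ubar y - h)) - ENNReal.ofReal (c₀ * T) := by
  obtain ⟨u, hu, -, hu0, hut⟩ := H
  have hneg : ∀ p q : ℝ → ℝ, eLpNorm (fun y => -p y - -q y) 1 volume
      = eLpNorm (fun y => p y - q y) 1 volume := by
    intro p q
    refine Eq.trans ?_ (eLpNorm_sub_comm q p 1 volume)
    congr 1; ext y; rw [Pi.sub_apply]; ring
  refine lintegral_ofReal_sub_le_of_tendsto hc₀ (fun w => ?_) (fun k => (hu k).neg)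
    (Lp.aestronglyMeasurable ubar).aemeasurable.neg hh hT
    (by simpa only [Pi.neg_apply, hneg] using hu0) (by simpa only [hneg] using hut T hT)
  linarith [le_gridInterp_sub hfg ν (-w)]

end IsApproxSemigroupSolution

namespace IsSemigroupSolution

variable {f g : ℝ → ℝ} {ubar : ℝ →₁[volume] ℝ} {u : ℝ → (ℝ →₁[volume] ℝ)} {c₀ : ℝ}

/-- The decay of the mass above `h` and below `-h` for the semigroup solution (the subtraction of
`c₀ * T` is truncated). -/
theorem lintegral_ofReal_sub_le (H : IsSemigroupSolution f g ubar u) (hc₀ : 0 < c₀)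
    (hfg : ∀ u, c₀ ≤ g u - f u) {h : ℝ} (hh : 0 ≤ h) {T : ℝ} (hT : 0 ≤ T) :
    ∫⁻ y, ENNReal.ofReal (u T y - h)
        ≤ (∫⁻ y, ENNReal.ofReal (ubar y - h)) - ENNReal.ofReal (c₀ * T) ∧
      ∫⁻ y, ENNReal.ofReal (-u T y - h)
        ≤ (∫⁻ y, ENNReal.ofReal (-ubar y - h)) - ENNReal.ofReal (c₀ * T) := by
  obtain ⟨w, hw, hlim⟩ := H
  have hL : Tendsto (fun ν => eLpNorm (fun y => w ν T y - u T y) 1 volume) atTop (𝓝 0) :=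
    (Lp.tendsto_Lp_iff_tendsto_eLpNorm' _ _).1 (hlim T hT)
  have hlim' : ∀ C : ENNReal, Tendsto
      (fun ν => C + eLpNorm (fun y => w ν T y - u T y) 1 volume) atTop (𝓝 C) := by
    intro C
    simpa using (tendsto_const_nhds (x := C)).add hL
  constructor
  · refine ge_of_tendsto (hlim' _) ?_
    filter_upwards [eventually_ge_atTop 1] with ν hν
    exact (lintegral_ofReal_sub_le_add_eLpNorm (a := w ν T)
      (Lp.aestronglyMeasurable _).aemeasurable h).trans
      (add_le_add_left ((hw ν hν).lintegral_ofReal_sub_le hc₀ hfg hh hT) _)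
  · refine ge_of_tendsto (hlim' _) ?_
    filter_upwards [eventually_ge_atTop 1] with ν hν
    have := lintegral_ofReal_sub_le_add_eLpNorm (a := fun y => -w ν T y) (b := fun y => -u T y)
      (Lp.aestronglyMeasurable _).aemeasurable.neg h
    refine this.trans (add_le_add
      ((hw ν hν).lintegral_ofReal_neg_sub_le hc₀ hfg hh hT) (le_of_eq ?_))
    refine Eq.trans ?_ (eLpNorm_sub_comm (u T) (w ν T) 1 volume)
    congr 1; ext y; rw [Pi.sub_apply]; ring

end IsSemigroupSolution

theorem tendsto_lintegral_ofReal_sub_natCast {a : ℝ → ℝ} (ha : Integrable a) :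
    Tendsto (fun n : ℕ => ∫⁻ y, ENNReal.ofReal (a y - n)) atTop (𝓝 0) := by
  have := tendsto_lintegral_of_dominated_convergence' (μ := volume)
    (F := fun (n : ℕ) y => ENNReal.ofReal (a y - n)) (f := fun _ => 0) (fun y => ‖a y‖ₑ)
    (fun n => by have := ha.aemeasurable; fun_prop) (fun n => ae_of_all _ fun y => ?_)
    ha.hasFiniteIntegral.ne (ae_of_all _ fun y => ?_)
  · simpa using this
  · simp only [Real.enorm_eq_ofReal_abs]
    exact ENNReal.ofReal_le_ofReal (by linarith [le_abs_self (a y), n.cast_nonneg (α := ℝ)])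
  · refine tendsto_const_nhds.congr' ?_
    obtain ⟨m, hm⟩ := exists_nat_ge (a y)
    filter_upwards [eventually_ge_atTop m] with n hn
    rw [ENNReal.ofReal_of_nonpos]
    have : (m : ℝ) ≤ n := by exact_mod_cast hn
    linarith

theorem ae_le_of_lintegral_ofReal_sub_eq_zero {a : ℝ → ℝ} (ha : AEMeasurable a) {h : ℝ}
    (h0 : ∫⁻ y, ENNReal.ofReal (a y - h) = 0) : ∀ᵐ y, a y ≤ h := by
  rw [lintegral_eq_zero_iff' (by fun_prop)] at h0
  filter_upwards [h0] with y hy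
  simpa using hy

/-! ### Boundedness and extinction -/

theorem proposition3p1 (f g : ℝ → ℝ) (hf : ContDiff ℝ 2 f) (hg : ContDiff ℝ 2 g)
    (c₀ : ℝ) (hc₀ : 0 < c₀) (hfg : ∀ u : ℝ, c₀ ≤ g u - f u)
    (ubar : ℝ →₁[volume] ℝ) (u : ℝ → (ℝ →₁[volume] ℝ))
    (hu : IsSemigroupSolution f g ubar u) :
    (∀ τ : ℝ, 0 < τ → eLpNorm (u τ) ⊤ volume < ⊤) ∧
    (∀ τ : ℝ, (1 / c₀) * (∫ x : ℝ, |ubar x|) ≤ τ → u τ = 0) := by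
  have hint : Integrable ubar := L1.integrable_coeFn ubar
  have hmeas : ∀ τ, AEMeasurable (u τ) := fun τ => (Lp.aestronglyMeasurable _).aemeasurable
  constructor
  · intro τ hτ
    have hpos : 0 < ENNReal.ofReal (c₀ * τ) := ENNReal.ofReal_pos.2 (mul_pos hc₀ hτ)
    -- At a high level the initial mass is so small that it disappears before time `τ`.
    obtain ⟨n, hn1, hn2⟩ := (((tendsto_lintegral_ofReal_sub_natCast hint).eventually_lt_const
      hpos).and ((tendsto_lintegral_ofReal_sub_natCast hint.neg).eventually_lt_const hpos)).exists
    obtain ⟨h1, h2⟩ := hu.lintegral_ofReal_sub_le hc₀ hfg n.cast_nonneg hτ.le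
    have h1 := ae_le_of_lintegral_ofReal_sub_eq_zero (hmeas τ)
      (le_antisymm (h1.trans_eq (tsub_eq_zero_of_le hn1.le)) zero_le)
    have h2 := ae_le_of_lintegral_ofReal_sub_eq_zero (hmeas τ).neg
      (le_antisymm (h2.trans_eq (tsub_eq_zero_of_le hn2.le)) zero_le)
    rw [eLpNorm_exponent_top]
    refine eLpNormEssSup_lt_top_of_ae_bound (C := n) ?_
    filter_upwards [h1, h2] with y hy1 hy2
    rw [Pi.neg_apply] at hy2
    exact abs_le.2 ⟨by linarith, hy1⟩
  · intro τ hτ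
    have hτ' : ∫ x, |ubar x| ≤ c₀ * τ := by
      rwa [one_div, inv_mul_le_iff₀ hc₀] at hτ
    have hτ0 : 0 ≤ τ := le_trans
      (mul_nonneg (by positivity) (integral_nonneg fun _ => abs_nonneg _)) hτ
    have hmass : ∫⁻ y, ENNReal.ofReal |ubar y| ≤ ENNReal.ofReal (c₀ * τ) := by
      rw [← ofReal_integral_eq_lintegral_ofReal hint.abs (ae_of_all _ fun _ => abs_nonneg _)]
      exact ENNReal.ofReal_le_ofReal hτ'
    obtain ⟨h1, h2⟩ := hu.lintegral_ofReal_sub_le hc₀ hfg le_rfl hτ0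
    have h1 := ae_le_of_lintegral_ofReal_sub_eq_zero (hmeas τ)
      (le_antisymm (h1.trans_eq (tsub_eq_zero_of_le (le_trans (lintegral_mono fun y =>
        ENNReal.ofReal_le_ofReal (by simpa using le_abs_self _)) hmass))) zero_le)
    have h2 := ae_le_of_lintegral_ofReal_sub_eq_zero (hmeas τ).neg
      (le_antisymm (h2.trans_eq (tsub_eq_zero_of_le (le_trans (lintegral_mono fun y =>
        ENNReal.ofReal_le_ofReal (by simpa using neg_le_abs _)) hmass))) zero_le)
    rw [Lp.eq_zero_iff_ae_eq_zero]
    filter_upwards [h1, h2] with y hy1 hy2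
    rw [Pi.neg_apply] at hy2
    exact le_antisymm hy1 (neg_nonpos.1 hy2)
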